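/- Let $H(\aleph_0)$ be the (countable, discrete) set of hereditarily finite sets, let $2^{<\omega}$ be the set of finite binary sequences, $2^{<n}$ the set of those of length $<n$, $lg(\rho)$ the length of $\rho$, $\le$ the initial segment relation, and for $\nu\in 2^{<\omega}$, $x\in 2^\omega$ let $\nu\cap x$ be their longest common initial segment. Let $\mathcal F_*$ be the set of all functions $f:2^{<\omega}\to H(\aleph_0)$ with the product topology, and let $\mathcal F_n^*=\{f\restriction 2^{<n}: f\in\mathcal F_*\}\subseteq H(\aleph_0)$. For $f,g\in\mathcal F_*$ let $eq(f,g)=\{\rho: f(\rho)=g(\rho)\}$ and $dif(f,g)=2^{<\omega}\setminus eq(f,g)$. Let $EDF$ be the set of all $\mathcal F\subseteq\mathcal F_*$ such that $eq(f,g)$ is finite for all $f\neq g$ in $\mathcal F$, and let $MEDF$ be the set of all $\mathcal F\in EDF$ that are maximal in $EDF$ under inclusion. Let $\mathbf B:\mathcal F_*\to 2^\omega$ be any injective continuous function. Define $F_1:\mathcal F_*\to\mathcal F_*$ by $F_1(f)(\rho)=f\restriction 2^{<lg(\rho)}$, and let $G_0=\{F_1(f): f\in\mathcal F_*\}$. Let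 $G_1$ be the set of $g\in\mathcal F_*$ for which there is $f\in\mathcal F_*$ such that $dif(g,F_1(f))$ is infinite and 1. for every $n$, only finitely many $\rho\in dif(g,F_1(f))$ satisfy $\mathbf B(f)\restriction n\not\le\rho$; 2. for every $\rho\in 2^{<\omega}$ with $\rho\le\mathbf B(f)$ there is at most one $\nu$ with $\rho\le\nu\in dif(g,F_1(f))$ and $\nu\cap\mathbf B(f)=\rho$. For $g\in G_1$ such an $f$ is unique and is denoted $f_g$; put $w_g=dif(g,F_1(f_g))$. Let $G_2$ be the set of $g\in G_1$ such that $g\restriction w_g=f_g\restriction w_g$ and either $g(\rho)\notin\mathcal F^*_{lg(\rho)}$ for all $\rho\in w_g$, or for all $\rho\ne\nu$ in $w_g$ we have $g(\rho)\in\mathcal F^*_{lg(\rho)}$ and $g(\rho)\not\subseteq g(\nu)$. Let $H_3=\{f_g: g\in G_2\}$. Then there is a Borel function $F_3^*:\mathcal F_*\to\mathcal F_*$ such that for every $f\in\mathcal F_*$: $f\in H_3$ if and only if $F_3^*(f)\in G_2$, and $f_{F_3^*(f)}=f$ whenever $f\in H_3$. Moreover, for every such $F_3^*$, the family $G_4=\{F_3^*(f):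 f\in H_3\}\cup\{F_1(f): f\in\mathcal F_*\setminus H_3\}$ satisfies: a. $G_4$ is Borel, $G_4\subseteq G_0\cup G_2$, and $G_2\subseteq G_1$; b. $G_4\in EDF$; c. $G_4\in MEDF$; moreover, for every $f\in\mathcal F_*$ there is $g\in G_4$ such that $eq(f,g)$ is infinite. -/

import Mathlib

namespace EvDiff

/-! ### Hereditarily finite sets and the space of functions -/

/-- `H(ℵ₀)`, the hereditarily finite sets, i.e. the elements of `V_ω`. -/
def HF : Type 1 := {x : ZFSet.{0} // x ∈ ZFSet.vonNeumann Ordinal.omega0}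

/-- `H(ℵ₀)` carries the discrete topology. -/
instance : TopologicalSpace HF := ⊥

instance : DiscreteTopology HF := ⟨rfl⟩

/-- The space of all functions from `2^{<ω}` (finite binary sequences) to `H(ℵ₀)`. Its topology is
the product topology. -/
abbrev FStar : Type 1 := List Bool → HF

/-- The set-theoretic finite binary sequence: the function `{(i, ρ(i)) : i < lg ρ}`, with von Neumann
natural numbers and Kuratowski pairs. -/
noncomputable def seqSet (ρ : List Bool) : ZFSet.{0} :=
  ZFSet.range fun i : Fin ρ.length =>
    ZFSet.pair (Ordinal.toZFSet (i : ℕ)) (Ordinal.toZFSet ((ρ.get i).toNat : ℕ))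

/-- The set-theoretic function `f ↾ 2^{<n} = {(ρ, f(ρ)) : lg ρ < n}`. -/
noncomputable def restrSet (f : FStar) (n : ℕ) : ZFSet.{0} :=
  ZFSet.range fun ρ : {ρ : List Bool // ρ.length < n} => ZFSet.pair (seqSet ρ.1) (f ρ.1).1

theorem mem_Vomega_range {ι : Type} [Finite ι] (u : ι → ZFSet.{0})
    (hu : ∀ i, u i ∈ ZFSet.vonNeumann Ordinal.omega0) :
    ZFSet.range u ∈ ZFSet.vonNeumann Ordinal.omega0 := by
  simp only [ZFSet.mem_vonNeumann, Ordinal.lt_omega0] at hu ⊢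
  choose m hm using hu
  obtain ⟨M, hM⟩ := (Set.finite_range m).bddAbove
  have h : (ZFSet.range u).rank ≤ ((M + 1 : ℕ) : Ordinal) := by
    rw [ZFSet.rank_le_iff]
    intro y hy
    obtain ⟨i, rfl⟩ := ZFSet.mem_range.1 hy
    rw [hm i]
    exact_mod_cast Nat.lt_succ_of_le (hM ⟨i, rfl⟩)
  exact Ordinal.lt_omega0.1 (h.trans_lt (Ordinal.natCast_lt_omega0 _))

theorem mem_Vomega_pair {x y : ZFSet.{0}} (hx : x ∈ ZFSet.vonNeumann Ordinal.omega0)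
    (hy : y ∈ ZFSet.vonNeumann Ordinal.omega0) :
    ZFSet.pair x y ∈ ZFSet.vonNeumann Ordinal.omega0 := by
  have hs : Order.IsSuccLimit Ordinal.omega0.{0} := Ordinal.isSuccLimit_omega0
  simp only [ZFSet.mem_vonNeumann] at hx hy ⊢
  simp only [ZFSet.pair, ZFSet.rank_pair, ZFSet.rank_singleton, max_lt_iff]
  have h1 := hs.succ_lt hx
  have h2 := hs.succ_lt hy
  rw [Order.succ_eq_add_one] at h1 h2
  refine ⟨hs.succ_lt ?_, hs.succ_lt ?_⟩ <;> simp [h1, h2]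

theorem mem_Vomega_nat (n : ℕ) :
    Ordinal.toZFSet (n : Ordinal.{0}) ∈ ZFSet.vonNeumann Ordinal.omega0 := by
  rw [ZFSet.mem_vonNeumann]
  simp

theorem seqSet_mem (ρ : List Bool) : seqSet ρ ∈ ZFSet.vonNeumann Ordinal.omega0 :=
  mem_Vomega_range _ fun _ => mem_Vomega_pair (mem_Vomega_nat _) (mem_Vomega_nat _)

theorem restrSet_mem (f : FStar) (n : ℕ) :
    restrSet f n ∈ ZFSet.vonNeumann Ordinal.omega0 := by
  have : Finite {ρ : List Bool // ρ.length < n} := List.finite_length_lt Bool n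
  exact mem_Vomega_range _ fun ρ => mem_Vomega_pair (seqSet_mem ρ.1) (f ρ.1).2

/-- `f ↾ 2^{<n}` as an element of `H(ℵ₀)`. -/
noncomputable def restr (f : FStar) (n : ℕ) : HF := ⟨restrSet f n, restrSet_mem f n⟩

/-- The set of all functions from `2^{<n}` to `H(ℵ₀)`. -/
def FStarN (n : ℕ) : Set HF := {x | ∃ f : FStar, x = restr f n}

/-! ### Eventually different families -/

/-- The set of places where `f` and `g` agree. -/
def eqSet (f g : FStar) : Set (List Bool) := {ρ | f ρ = g ρ}

/-- The set of places where `f` and `g` differ. -/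
def difSet (f g : FStar) : Set (List Bool) := (eqSet f g)ᶜ

/-- The eventually different families. -/
def EDF : Set (Set FStar) := {F | ∀ f ∈ F, ∀ g ∈ F, f ≠ g → (eqSet f g).Finite}

/-- The maximal eventually different families (maximal with respect to inclusion). -/
def MEDF : Set (Set FStar) := {F | Maximal (fun F' => F' ∈ EDF) F}

/-! ### The families `G₀`, `G₁`, `G₂` and the set `H₃` -/

/-- The initial segment `x ↾ n` of an infinite binary sequence. -/
def seg (x : ℕ → Bool) (n : ℕ) : List Bool := (List.range n).map x

/-- The longest common initial segment `ν ∩ x` of a finite and an infinite binary sequence. -/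
def meet : List Bool → (ℕ → Bool) → List Bool
  | [], _ => []
  | a :: ν, x => if a = x 0 then a :: meet ν (fun n => x (n + 1)) else []

/-- `F₁(f)(ρ) = f ↾ 2^{<lg ρ}`. -/
noncomputable def F1 (f : FStar) : FStar := fun ρ => restr f ρ.length

def G0 : Set FStar := Set.range F1

/-- `f` witnesses that `g` belongs to `G₁`. -/
structure IsIndex (B : FStar → ℕ → Bool) (g f : FStar) : Prop where
  infinite : (difSet g (F1 f)).Infinite
  finite_off : ∀ n : ℕ, {ρ | ¬ seg (B f) n <+: ρ ∧ ρ ∈ difSet g (F1 f)}.Finite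
  at_most_one : ∀ ρ : List Bool, ρ = seg (B f) ρ.length →
    {ν | ρ <+: ν ∧ ν ∈ difSet g (F1 f) ∧ meet ν (B f) = ρ}.Subsingleton

def G1 (B : FStar → ℕ → Bool) : Set FStar := {g | ∃ f, IsIndex B g f}

open Classical in
/-- For `g ∈ G₁`, the witness `f_g` (it is unique, see `IsIndex.unique`); the value is irrelevant
when `g ∉ G₁`. -/
noncomputable def idx (B : FStar → ℕ → Bool) (g : FStar) : FStar :=
  if h : ∃ f, IsIndex B g f then h.choose else g

/-- `w_g = dif(g, F₁(f_g))`. -/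
def wSet (B : FStar → ℕ → Bool) (g : FStar) : Set (List Bool) := difSet g (F1 (idx B g))

def G2 (B : FStar → ℕ → Bool) : Set FStar :=
  {g | g ∈ G1 B ∧ (∀ ρ ∈ wSet B g, g ρ = idx B g ρ) ∧
    ((∀ ρ ∈ wSet B g, g ρ ∉ FStarN ρ.length) ∨
      (∀ ρ ∈ wSet B g, ∀ ν ∈ wSet B g, ρ ≠ ν →
        g ρ ∈ FStarN ρ.length ∧ ¬ (g ρ).1 ⊆ (g ν).1))}

def H3 (B : FStar → ℕ → Bool) : Set FStar := {f | ∃ g ∈ G2 B, idx B g = f}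

/-- `F₃` is a Borel function that picks for each `f ∈ H₃` an element of `G₂` with index `f`, and
takes values outside `G₂` off `H₃`. -/
structure IsSelector (B : FStar → ℕ → Bool) (F3 : FStar → FStar) : Prop where
  borel : @Measurable FStar FStar (borel FStar) (borel FStar) F3
  mem_iff : ∀ f, f ∈ H3 B ↔ F3 f ∈ G2 B
  idx_eq : ∀ f ∈ H3 B, idx B (F3 f) = f

/-- `G₄ = {F₃(f) : f ∈ H₃} ∪ {F₁(f) : f ∉ H₃}`. -/
def G4 (B : FStar → ℕ → Bool) (F3 : FStar → FStar) : Set FStar :=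
  F3 '' H3 B ∪ F1 '' (H3 B)ᶜ

/-! ### Uniqueness of `f_g` -/

theorem seqSet_injective : Function.Injective seqSet := by
  have key : ∀ (ρ : List Bool) (i b : ℕ),
      ZFSet.pair (Ordinal.toZFSet (i : Ordinal.{0})) (Ordinal.toZFSet (b : Ordinal.{0})) ∈ seqSet ρ
        ↔ ∃ h : i < ρ.length, (ρ[i]).toNat = b := by
    intro ρ i b
    simp only [seqSet, ZFSet.mem_range, ZFSet.pair_inj]
    constructor
    · rintro ⟨j, h1, h2⟩
      have h1' : (j : ℕ) = i := by exact_mod_cast Ordinal.toZFSet_injective h1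
      have h2' : (ρ.get j).toNat = b := by exact_mod_cast Ordinal.toZFSet_injective h2
      subst h1'
      exact ⟨j.2, by simpa using h2'⟩
    · rintro ⟨h, rfl⟩
      exact ⟨⟨i, h⟩, rfl, rfl⟩
  intro ρ σ h
  have hl : ∀ i : ℕ, i < ρ.length ↔ i < σ.length := by
    intro i
    constructor
    · intro hi
      have := (key ρ i _).2 ⟨hi, rfl⟩
      rw [h] at this
      exact ((key σ i _).1 this).1
    · intro hi
      have := (key σ i _).2 ⟨hi, rfl⟩
      rw [← h] at this
      exact ((key ρ i _).1 this).1
  apply List.ext_getElem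
  · exact le_antisymm (le_of_not_gt fun hh => by simpa using (hl _).1 hh)
      (le_of_not_gt fun hh => by simpa using (hl _).2 hh)
  · intro i h1 h2
    have := (key ρ i _).2 ⟨h1, rfl⟩
    rw [h] at this
    obtain ⟨_, h3⟩ := (key σ i _).1 this
    revert h3
    cases ρ[i] <;> cases σ[i] <;> simp

theorem restr_eq_iff {f g : FStar} {n : ℕ} :
    restr f n = restr g n ↔ ∀ ρ : List Bool, ρ.length < n → f ρ = g ρ := by
  constructor
  · intro h ρ hρ
    have h' : restrSet f n = restrSet g n := congrArg Subtype.val h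
    have : ZFSet.pair (seqSet ρ) (f ρ).1 ∈ restrSet f n := ZFSet.mem_range.2 ⟨⟨ρ, hρ⟩, rfl⟩
    rw [h'] at this
    obtain ⟨σ, hσ⟩ := ZFSet.mem_range.1 this
    obtain ⟨h1, h2⟩ := ZFSet.pair_inj.1 hσ
    rw [seqSet_injective h1] at h2
    exact Subtype.ext h2.symm
  · intro h
    apply Subtype.ext
    change restrSet f n = restrSet g n
    unfold restrSet
    congr 1
    funext ρ
    rw [h ρ.1 ρ.2]

theorem meet_prefix (ν : List Bool) (x : ℕ → Bool) : meet ν x <+: ν := by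
  induction ν generalizing x with
  | nil => simp [meet]
  | cons a ν ih =>
    unfold meet
    split
    · exact (List.prefix_cons_inj a).2 (ih _)
    · simp

theorem meet_eq_seg (ν : List Bool) (x : ℕ → Bool) : meet ν x = seg x (meet ν x).length := by
  induction ν generalizing x with
  | nil => simp [meet, seg]
  | cons a ν ih =>
    unfold meet
    split
    · rename_i h
      have := ih (fun n => x (n + 1))
      rw [List.length_cons, seg, List.range_succ_eq_map, List.map_cons, List.map_map, ← h]
      congr 1
    · simp [seg]

/-- At each level `2^n` there are at most `n + 1` places where `g` differs from `F₁(f)`. -/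
theorem IsIndex.card_le {B : FStar → ℕ → Bool} {g f : FStar} (h : IsIndex B g f) (n : ℕ)
    (s : Finset (List Bool)) (hs : ∀ ν ∈ s, ν.length = n ∧ ν ∈ difSet g (F1 f)) :
    s.card ≤ n + 1 := by
  have : s.card ≤ (Finset.range (n + 1)).card := by
    apply Finset.card_le_card_of_injOn (fun ν => (meet ν (B f)).length)
    · intro ν hν
      have := (meet_prefix ν (B f)).length_le
      rw [(hs ν hν).1] at this
      simpa using Nat.lt_succ_of_le this
    · intro ν hν μ hμ hνμ
      have e : meet μ (B f) = meet ν (B f) := by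
        rw [meet_eq_seg ν, meet_eq_seg μ]
        exact congrArg _ hνμ.symm
      exact h.at_most_one (meet ν (B f)) (meet_eq_seg _ _)
        ⟨meet_prefix _ _, (hs ν hν).2, rfl⟩ ⟨e ▸ meet_prefix _ _, (hs μ hμ).2, e⟩
  simpa using this

theorem IsIndex.unique {B : FStar → ℕ → Bool} {g f f' : FStar} (h : IsIndex B g f)
    (h' : IsIndex B g f') : f = f' := by
  classical
  funext ρ
  set n := ρ.length + 4 with hn
  by_contra hne
  let s : Finset (List Bool) :=
    Finset.univ.map ⟨fun v : List.Vector Bool n => v.1, Subtype.val_injective⟩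
  have hlen : ∀ ν ∈ s, ν.length = n := by
    intro ν hν
    obtain ⟨v, -, rfl⟩ := Finset.mem_map.1 hν
    exact v.2
  have hcard : s.card = 2 ^ n := by simp [s]
  have hsub : s ⊆ s.filter (· ∈ difSet g (F1 f)) ∪ s.filter (· ∈ difSet g (F1 f')) := by
    intro ν hν
    by_contra hcon
    simp only [Finset.mem_union, Finset.mem_filter, hν, true_and, not_or, difSet,
      Set.mem_compl_iff, not_not, eqSet, Set.mem_ofPred_eq] at hcon
    have e : restr f ν.length = restr f' ν.length := hcon.1.symm.trans hcon.2
    exact hne (restr_eq_iff.1 e ρ (by rw [hlen ν hν]; omega))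
  have h1 := Finset.card_le_card hsub
  have h2 := Finset.card_union_le (s.filter (· ∈ difSet g (F1 f)))
    (s.filter (· ∈ difSet g (F1 f')))
  have h3 := h.card_le n (s.filter (· ∈ difSet g (F1 f))) fun ν hν =>
    ⟨hlen ν (Finset.mem_filter.1 hν).1, (Finset.mem_filter.1 hν).2⟩
  have h4 := h'.card_le n (s.filter (· ∈ difSet g (F1 f'))) fun ν hν =>
    ⟨hlen ν (Finset.mem_filter.1 hν).1, (Finset.mem_filter.1 hν).2⟩
  have h5 : ∀ m : ℕ, 2 * (m + 4 + 1) < 2 ^ (m + 4) := by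
    intro m
    induction m with
    | zero => norm_num
    | succ m ih => rw [show m + 1 + 4 = (m + 4) + 1 by ring, pow_succ]; omega
  have h6 := h5 ρ.length
  rw [← hn] at h6
  rw [hcard] at h1
  omega

theorem IsIndex.idx_eq {B : FStar → ℕ → Bool} {g f : FStar} (h : IsIndex B g f) :
    idx B g = f := by
  have hex : ∃ f, IsIndex B g f := ⟨f, h⟩
  rw [idx, dif_pos hex]
  exact hex.choose_spec.unique h

end EvDiff

/-!
A function `f` lies in `H₃` exactly when there is an infinite set of places at which `f` differs from
`F₁(f)`, such that the places branch off `B f` at different levels and the values of `f` there are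
either all outside, or all inside and pairwise incomparable in, the tree of functions on the levels
`2^{<n}`. Such a set is an infinite clique of the relation `Compatible`.

The initial segments of a tree node form a chain, and therefore no node extends two incomparable
ones. It follows (`Extendable.exists_insert`) that a finite clique contained in arbitrarily large
finite cliques can be enlarged by a point without losing this property. A greedy choice along an
enumeration of `2^{<ω}` then produces an infinite clique. Thus the existence of an infinite clique is
equivalent to a condition on finite cliques only, which makes `H₃` Borel (`mem_H3_iff`,
`measurableSet_H3`), and the greedy clique depends on `f` in a Borel way, which gives the selector
(`isSelector_select`). The family `G₄` is a union of two injective Borel images of Borel sets, hence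
Borel by the Lusin–Souslin theorem.

Two members of `G₄` come from different functions `f ≠ f'`. They agree at finitely many places: `F₁(f)`
and `F₁(f')` eventually differ, the exceptional sets converge to `B f ≠ B f'` and so have finite
intersection, and on an exceptional set at most one value can be of the form `f' ↾ 2^{<n}`.

For `f ∈ H₃` the function `F₃(f)` agrees with `f` on an infinite set. For `f ∉ H₃`, consider the places
leaving `B f` one step after an initial segment. If `f` agrees with `F₁(f)` at infinitely many of
them, `F₁(f)` is as required. Otherwise `f ∉ H₃` excludes infinite antichains of values, so there is
an infinite chain of values; its union `f'` has `F₁(f')` equal to `f` at infinitely many of these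
places (`exists_F1_eq_of_notMem_H3`). Passing from `F₁(f')` to `F₃(f')` changes only a set converging
to `B f' ≠ B f`, which loses only finitely many of these places.
-/

namespace EvDiff

open Topology

/-! ### Infinite cliques and a greedy choice of them -/

section Cliques

variable {α : Type*}

/-- The finite set `s` lies in arbitrarily large finite cliques of the relation `R`. -/
def Extendable (R : α → α → Prop) (s : Finset α) : Prop :=
  ∀ k : ℕ, ∃ t : Finset α, s ⊆ t ∧ k ≤ t.card ∧ (t : Set α).Pairwise R

theorem Extendable.anti {R : α → α → Prop} {s s' : Finset α} (h : Extendable R s')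
    (hs : s ⊆ s') : Extendable R s := fun k =>
  let ⟨t, ht, hk, hR⟩ := h k
  ⟨t, hs.trans ht, hk, hR⟩

theorem Extendable.pairwise {R : α → α → Prop} {s : Finset α} (h : Extendable R s) :
    (s : Set α).Pairwise R :=
  let ⟨_, ht, _, hR⟩ := h 0
  hR.mono (Finset.coe_subset.2 ht)

theorem extendable_empty_of_infinite {R : α → α → Prop} {w : Set α} (hw : w.Infinite)
    (hR : w.Pairwise R) : Extendable R ∅ := fun k =>
  let ⟨t, ht, hk⟩ := hw.exists_subset_card_eq k
  ⟨t, Finset.empty_subset _, hk.ge, hR.mono ht⟩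

/-- Vertices satisfying `V` are adjacent when they have different colours and are incomparable for
`le`. -/
def RainbowAntichain (V : α → Prop) (c : α → ℕ) (le : α → α → Prop) (a b : α) : Prop :=
  V a ∧ V b ∧ c a ≠ c b ∧ ¬ le a b ∧ ¬ le b a

theorem RainbowAntichain.symm {V : α → Prop} {c : α → ℕ} {le : α → α → Prop} {a b : α}
    (h : RainbowAntichain V c le a b) : RainbowAntichain V c le b a :=
  ⟨h.2.1, h.1, h.2.2.1.symm, h.2.2.2.2, h.2.2.2.1⟩

/-- When the predecessors of every vertex form a chain, an extendable set has a one-point extendable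
extension. If `a` and `b` are incomparable, no vertex is above both, so up to at most four vertices
every clique splits into a part compatible with `a` and a part compatible with `b`; hence one of the
two points is compatible with arbitrarily large cliques. -/
theorem Extendable.exists_insert [DecidableEq α] {V : α → Prop} {c : α → ℕ} {le : α → α → Prop}
    (htree : ∀ a b z, le a z → le b z → le a b ∨ le b a) {s : Finset α}
    (h : Extendable (RainbowAntichain V c le) s) :
    ∃ a, a ∉ s ∧ Extendable (RainbowAntichain V c le) (insert a s) := by
  classical
  set R := RainbowAntichain V c le with hRdef
  obtain ⟨t, hst, htc, htR⟩ := h (s.card + 2)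
  have hcard : 1 < (t \ s).card := by
    rw [Finset.card_sdiff_of_subset hst]; omega
  obtain ⟨a, ha, b, hb, hab⟩ := Finset.one_lt_card.1 hcard
  rw [Finset.mem_sdiff] at ha hb
  by_contra! hcon
  -- the clique-size bounds beyond which `insert a s` and `insert b s` cannot be extended
  have hka := hcon a ha.2
  have hkb := hcon b hb.2
  simp only [Extendable, not_forall] at hka hkb
  obtain ⟨ka, hka⟩ := hka
  obtain ⟨kb, hkb⟩ := hkb
  obtain ⟨u, hsu, huc, huR⟩ := h (s.card + (ka + kb + 4))
  set A := u \ s with hA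
  have hAc : ka + kb + 4 ≤ A.card := by
    rw [hA, Finset.card_sdiff_of_subset hsu]; omega
  have hAR : (A : Set α).Pairwise R := huR.mono (by simp [hA])
  have hAV : ∀ z ∈ A, V z := by
    intro z hz
    obtain ⟨y, hy, hyz⟩ := Finset.exists_mem_ne (by omega : 1 < A.card) z
    exact (hAR hy hz hyz).2.1
  have hlarge : ∀ d ∈ t \ s, ∀ k, k ≤ (A.filter (R d)).card →
      ∃ t' : Finset α, insert d s ⊆ t' ∧ k ≤ t'.card ∧ (t' : Set α).Pairwise R := by
    intro d hd k hk
    rw [Finset.mem_sdiff] at hd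
    refine ⟨insert d (s ∪ A.filter (R d)), ?_, ?_, ?_⟩
    · exact Finset.insert_subset_insert _ Finset.subset_union_left
    · exact hk.trans (Finset.card_le_card
        (Finset.subset_union_right.trans (Finset.subset_insert _ _)))
    · rw [Finset.coe_insert]
      have : Std.Symm R := ⟨fun _ _ => RainbowAntichain.symm⟩
      refine Set.Pairwise.insert_of_symm (huR.mono ?_) ?_
      · intro z hz
        rcases Finset.mem_union.1 (Finset.mem_coe.1 hz) with hz | hz
        · exact hsu hz
        · exact (Finset.mem_sdiff.1 (Finset.mem_filter.1 hz).1).1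
      · intro z hz hdz
        rcases Finset.mem_union.1 (Finset.mem_coe.1 hz) with hz | hz
        · exact htR hd.1 (hst hz) hdz
        · exact (Finset.mem_filter.1 hz).2
  have hcol : ∀ d, (A.filter fun z => c z = c d).card ≤ 1 := by
    intro d
    refine Finset.card_le_one.2 fun x hx y hy => ?_
    rw [Finset.mem_filter] at hx hy
    by_contra hxy
    exact (hAR hx.1 hy.1 hxy).2.2.1 (hx.2.trans hy.2.symm)
  have hbelow : ∀ d, (A.filter fun z => le z d).card ≤ 1 := by
    intro d
    refine Finset.card_le_one.2 fun x hx y hy => ?_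
    rw [Finset.mem_filter] at hx hy
    by_contra hxy
    obtain ⟨-, -, -, h1, h2⟩ := hAR hx.1 hy.1 hxy
    exact (htree x y d hx.2 hy.2).elim h1 h2
  have hcover : A ⊆ A.filter (R a) ∪ A.filter (R b) ∪
      ((A.filter fun z => c z = c a) ∪ (A.filter fun z => c z = c b) ∪
      ((A.filter fun z => le z a) ∪ (A.filter fun z => le z b))) := by
    intro z hz
    have hVz := hAV z hz
    obtain ⟨hVa, hVb, -, hnab, hnba⟩ := htR ha.1 hb.1 hab
    by_contra hn
    simp only [Finset.mem_union, Finset.mem_filter, hz, true_and, not_or] at hn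
    obtain ⟨⟨hRa, hRb⟩, ⟨hca, hcb⟩, hla, hlb⟩ := hn
    have haz : le a z := by
      by_contra haz
      exact hRa ⟨hVa, hVz, Ne.symm hca, haz, hla⟩
    have hbz : le b z := by
      by_contra hbz
      exact hRb ⟨hVb, hVz, Ne.symm hcb, hbz, hlb⟩
    exact (htree a b z haz hbz).elim hnab hnba
  have hsum := Finset.card_le_card hcover
  have h1 := Finset.card_union_le (A.filter (R a) ∪ A.filter (R b))
    ((A.filter fun z => c z = c a) ∪ (A.filter fun z => c z = c b) ∪
      ((A.filter fun z => le z a) ∪ (A.filter fun z => le z b)))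
  have h2 := Finset.card_union_le (A.filter (R a)) (A.filter (R b))
  have h3 := Finset.card_union_le ((A.filter fun z => c z = c a) ∪ (A.filter fun z => c z = c b))
    ((A.filter fun z => le z a) ∪ (A.filter fun z => le z b))
  have h4 := Finset.card_union_le (A.filter fun z => c z = c a) (A.filter fun z => c z = c b)
  have h5 := Finset.card_union_le (A.filter fun z => le z a) (A.filter fun z => le z b)
  have hc1 := hcol a
  have hc2 := hcol b
  have hb1 := hbelow a
  have hb2 := hbelow b
  rcases le_or_gt ka (A.filter (R a)).card with hle | hlt
  · exact hka (hlarge a (Finset.mem_sdiff.2 ha) ka hle)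
  · exact hkb (hlarge b (Finset.mem_sdiff.2 hb) kb (by omega))

open Classical in
/-- The finite stages of the greedy clique along the enumeration `e`: the point `e i` is added if
the result is extendable. -/
noncomputable def greedy (R : α → α → Prop) (e : ℕ → α) : ℕ → Finset α
  | 0 => ∅
  | i + 1 => if Extendable R (insert (e i) (greedy R e i)) then insert (e i) (greedy R e i)
      else greedy R e i

/-- The set of all points chosen by the greedy procedure. -/
def greedySet (R : α → α → Prop) (e : ℕ → α) : Set α := {a | ∃ i, a ∈ greedy R e i}

theorem greedy_mono (R : α → α → Prop) (e : ℕ → α) : Monotone (greedy R e) := by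
  classical
  refine monotone_nat_of_le_succ fun i => ?_
  rw [greedy]
  split_ifs
  · exact Finset.subset_insert _ _
  · exact le_rfl

theorem extendable_greedy {R : α → α → Prop} (e : ℕ → α) (h : Extendable R ∅) (i : ℕ) :
    Extendable R (greedy R e i) := by
  induction i with
  | zero => exact h
  | succ i ih =>
    rw [greedy]
    split_ifs with h'
    · convert h'
    · exact ih

theorem pairwise_greedySet {R : α → α → Prop} (e : ℕ → α) (h : Extendable R ∅) :
    (greedySet R e).Pairwise R := by
  rintro a ⟨i, hi⟩ b ⟨j, hj⟩ hab
  exact (extendable_greedy e h (max i j)).pairwise (greedy_mono R e (le_max_left i j) hi)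
    (greedy_mono R e (le_max_right i j) hj) hab

/-- A rejected point would also be rejected at any later stage, so the greedy procedure cannot stop
at a finite set. -/
theorem infinite_greedySet {V : α → Prop} {c : α → ℕ} {le : α → α → Prop} {e : ℕ → α}
    (he : Function.Surjective e)
    (htree : ∀ a b z, le a z → le b z → le a b ∨ le b a)
    (h : Extendable (RainbowAntichain V c le) ∅) :
    (greedySet (RainbowAntichain V c le) e).Infinite := by
  classical
  intro hfin
  set R := RainbowAntichain V c le
  have hst : ∃ i, ∀ a ∈ greedySet R e, a ∈ greedy R e i := by
    choose! m hm using fun a (ha : a ∈ greedySet R e) => (ha : ∃ i, a ∈ greedy R e i)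
    obtain ⟨M, hM⟩ := (hfin.image m).bddAbove
    exact ⟨M, fun a ha => greedy_mono R e (hM ⟨a, ha, rfl⟩) (hm a ha)⟩
  obtain ⟨i, hi⟩ := hst
  obtain ⟨a, ha, hext⟩ := (extendable_greedy e h i).exists_insert htree
  obtain ⟨j, rfl⟩ := he a
  refine ha (hi _ ⟨j + 1, ?_⟩)
  have hsub : greedy R e j ⊆ greedy R e i := fun b hb => hi b ⟨j, hb⟩
  rw [greedy, if_pos]
  · exact Finset.mem_insert_self _ _
  · convert hext.anti (Finset.insert_subset_insert (e j) hsub)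

section Measurability

variable {X : Type*} [MeasurableSpace X] [Countable α]

theorem measurableSet_extendable {R : X → α → α → Prop}
    (hR : ∀ a b, MeasurableSet {x | R x a b}) (s : Finset α) :
    MeasurableSet {x | Extendable (R x) s} := by
  simp only [Extendable, Set.Pairwise]
  simp only [measurableSet_setOfPred] at hR ⊢
  refine .forall fun k => .exists fun t => .and measurable_const (.and measurable_const ?_)
  exact .forall fun a => .imp measurable_const <| .forall fun b => .imp measurable_const <|
    .imp measurable_const (hR a b)

theorem measurableSet_greedy_eq {R : X → α → α → Prop} (e : ℕ → α)
    (hR : ∀ a b, MeasurableSet {x | R x a b}) (i : ℕ) (s : Finset α) :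
    MeasurableSet {x | greedy (R x) e i = s} := by
  classical
  induction i generalizing s with
  | zero => exact MeasurableSet.const (∅ = s)
  | succ i ih =>
    have : {x | greedy (R x) e (i + 1) = s} = ⋃ t : Finset α, {x | greedy (R x) e i = t} ∩
        {x | Extendable (R x) (insert (e i) t) ∧ insert (e i) t = s ∨
          ¬ Extendable (R x) (insert (e i) t) ∧ t = s} := by
      ext x
      simp only [Set.mem_iUnion, Set.mem_inter_iff, Set.mem_ofPred_eq, exists_eq_left']
      rw [greedy]
      split_ifs with h
      · have h' : Extendable (R x) (insert (e i) (greedy (R x) e i)) := by convert h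
        simp only [h', true_and, not_true_eq_false, false_and, or_false]
      · have h' : ¬ Extendable (R x) (insert (e i) (greedy (R x) e i)) := by convert h
        simp [h']
    rw [this]
    refine .iUnion fun t => (ih t).inter ?_
    have hm := measurableSet_extendable hR (insert (e i) t)
    simp only [measurableSet_setOfPred] at hm ⊢
    exact (hm.and measurable_const).or (hm.not.and measurable_const)

theorem measurableSet_mem_greedySet {R : X → α → α → Prop} (e : ℕ → α)
    (hR : ∀ a b, MeasurableSet {x | R x a b}) (a : α) :
    MeasurableSet {x | a ∈ greedySet (R x) e} := by
  have : {x | a ∈ greedySet (R x) e} =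
      ⋃ (i : ℕ) (s : Finset α) (_ : a ∈ s), {x | greedy (R x) e i = s} := by
    ext x
    simp [greedySet]
  rw [this]
  exact .iUnion fun i => .iUnion fun s => .iUnion fun _ => measurableSet_greedy_eq e hR i s

end Measurability

end Cliques

/-! ### The space of functions -/

instance : Countable HF := by
  have hfin : ∀ n : ℕ, {x : ZFSet.{0} | x.rank < n}.Finite := by
    intro n
    induction n with
    | zero => simp
    | succ n ih =>
      refine Set.Finite.of_finite_image (f := fun x : ZFSet.{0} => {y : ZFSet.{0} | y ∈ x})
        (ih.finite_subsets.subset ?_) ?_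
      · rintro _ ⟨x, hx, rfl⟩ y hy
        have h1 : x.rank ≤ n := by
          rw [Set.mem_ofPred_eq, Nat.cast_succ] at hx
          exact Order.lt_succ_iff.1 (by simpa using hx)
        exact (ZFSet.rank_lt_of_mem hy).trans_le h1
      · intro x _ y _ hxy
        ext z
        exact Set.ext_iff.1 hxy z
  have hV : {x : ZFSet.{0} | x ∈ ZFSet.vonNeumann Ordinal.omega0} =
      ⋃ n : ℕ, {x : ZFSet.{0} | x.rank < n} := by
    ext x
    simp only [ZFSet.mem_vonNeumann, Set.mem_ofPred_eq, Set.mem_iUnion]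
    constructor
    · intro h
      obtain ⟨n, hn⟩ := Ordinal.lt_omega0.1 h
      exact ⟨n + 1, by rw [hn]; exact_mod_cast Nat.lt_succ_self n⟩
    · rintro ⟨n, hn⟩
      exact hn.trans (Ordinal.natCast_lt_omega0 n)
  have : {x : ZFSet.{0} | x ∈ ZFSet.vonNeumann Ordinal.omega0}.Countable := by
    rw [hV]
    exact Set.countable_iUnion fun n => (hfin n).countable
  exact this.to_subtype

instance : MeasurableSpace HF := ⊤

instance : BorelSpace HF := ⟨(borel_eq_top_of_discrete).symm⟩

theorem borel_FStar_eq : borel FStar = MeasurableSpace.pi :=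
  (BorelSpace.measurable_eq (α := FStar)).symm

/-- Initial parts of functions are ordered by extension. -/
theorem restr_subset_iff {u v : FStar} {n m : ℕ} :
    (restr u n).1 ⊆ (restr v m).1 ↔ n ≤ m ∧ ∀ ρ : List Bool, ρ.length < n → u ρ = v ρ := by
  have key : ∀ (w : FStar) (k : ℕ) (ρ : List Bool) (x : HF),
      ZFSet.pair (seqSet ρ) x.1 ∈ (restr w k).1 ↔ ρ.length < k ∧ w ρ = x := by
    intro w k ρ x
    simp only [restr, restrSet, ZFSet.mem_range, ZFSet.pair_inj]
    constructor
    · rintro ⟨σ, h1, h2⟩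
      obtain rfl := seqSet_injective h1
      exact ⟨σ.2, Subtype.ext h2⟩
    · rintro ⟨h, rfl⟩
      exact ⟨⟨ρ, h⟩, rfl, rfl⟩
  constructor
  · intro h
    have h' : ∀ ρ : List Bool, ρ.length < n → ρ.length < m ∧ v ρ = u ρ := fun ρ hρ =>
      (key v m ρ (u ρ)).1 (h ((key u n ρ (u ρ)).2 ⟨hρ, rfl⟩))
    refine ⟨le_of_not_gt fun hmn => ?_, fun ρ hρ => (h' ρ hρ).2.symm⟩
    simpa using (h' (List.replicate m true) (by simpa using hmn)).1
  · rintro ⟨hnm, h⟩ z hz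
    obtain ⟨⟨ρ, hρ⟩, rfl⟩ := ZFSet.mem_range.1 hz
    exact (key v m ρ (u ρ)).2 ⟨hρ.trans_le hnm, (h ρ hρ).symm⟩

theorem F1_injective : Function.Injective F1 := by
  intro f g h
  funext ρ
  have h' := congrFun h (ρ ++ [true])
  exact restr_eq_iff.1 h' ρ (by simp)

theorem finite_eqSet_F1 {f g : FStar} (h : f ≠ g) : (eqSet (F1 f) (F1 g)).Finite := by
  obtain ⟨ρ, hρ⟩ := Function.ne_iff.1 h
  refine (List.finite_length_le Bool ρ.length).subset fun ν hν => ?_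
  by_contra hlt
  exact hρ (restr_eq_iff.1 hν ρ (not_le.1 hlt))

theorem F1_mem_FStarN (f : FStar) (ρ : List Bool) : F1 f ρ ∈ FStarN ρ.length := ⟨f, rfl⟩

/-! ### Branching levels along an infinite sequence -/

theorem length_seg (x : ℕ → Bool) (n : ℕ) : (seg x n).length = n := by simp [seg]

theorem seg_prefix_seg (x : ℕ → Bool) {m n : ℕ} (h : m ≤ n) : seg x m <+: seg x n := by
  obtain ⟨k, rfl⟩ := Nat.exists_eq_add_of_le h
  rw [seg, seg, List.range_add, List.map_append]
  exact List.prefix_append _ _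

theorem seg_prefix_of_le_length_meet {x : ℕ → Bool} {ρ : List Bool} {n : ℕ}
    (h : n ≤ (meet ρ x).length) : seg x n <+: ρ := by
  have h1 := seg_prefix_seg x h
  rw [← meet_eq_seg] at h1
  exact h1.trans (meet_prefix ρ x)

theorem meet_eq_of_length_eq {x : ℕ → Bool} {ρ ν : List Bool}
    (h : (meet ρ x).length = (meet ν x).length) : meet ρ x = meet ν x := by
  rw [meet_eq_seg ρ, meet_eq_seg ν, h]

/-- The sequence that follows `x` for `n` steps and then leaves it. -/
def offBranch (x : ℕ → Bool) (n : ℕ) : List Bool := seg x n ++ [!x n]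

theorem length_offBranch (x : ℕ → Bool) (n : ℕ) : (offBranch x n).length = n + 1 := by
  simp [offBranch, length_seg]

theorem length_meet_offBranch (x : ℕ → Bool) (n : ℕ) : (meet (offBranch x n) x).length = n := by
  induction n generalizing x with
  | zero => simp [offBranch, seg, meet]
  | succ n ih =>
    have : offBranch x (n + 1) = x 0 :: offBranch (fun n => x (n + 1)) n := by
      simp [offBranch, seg, List.range_succ_eq_map, Function.comp_def]
    rw [this, meet, if_pos rfl, List.length_cons, ih]

theorem offBranch_injective (x : ℕ → Bool) : Function.Injective (offBranch x) := by
  intro n m h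
  simpa [length_offBranch] using congrArg List.length h

/-- Sets converging to different points of the Cantor space have finite intersection. -/
theorem finite_inter_of_ne {x y : ℕ → Bool} (hxy : x ≠ y) {w v : Set (List Bool)}
    (hw : ∀ n, {ρ | ¬ seg x n <+: ρ ∧ ρ ∈ w}.Finite)
    (hv : ∀ n, {ρ | ¬ seg y n <+: ρ ∧ ρ ∈ v}.Finite) : (w ∩ v).Finite := by
  obtain ⟨n, hn⟩ := Function.ne_iff.1 hxy
  refine ((hw (n + 1)).union (hv (n + 1))).subset fun ρ hρ => ?_
  by_contra hcon
  simp only [Set.mem_union, Set.mem_ofPred_eq, hρ.1, hρ.2, and_true, not_or, not_not] at hcon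
  have he : seg x (n + 1) = seg y (n + 1) :=
    (List.prefix_of_prefix_length_le hcon.1 hcon.2 (by simp [length_seg])).eq_of_length
      (by simp [length_seg])
  simp only [seg, List.range_succ, List.map_append, List.map_cons, List.map_nil] at he
  exact hn (by simpa using (List.append_inj he (by simp)).2)

/-- Sets with pairwise different branching levels along `x` converge to `x`. -/
theorem finite_not_seg_prefix {x : ℕ → Bool} {w : Set (List Bool)}
    (hw : Set.InjOn (fun ρ => (meet ρ x).length) w) (n : ℕ) :
    {ρ | ¬ seg x n <+: ρ ∧ ρ ∈ w}.Finite := by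
  refine Set.Finite.of_finite_image (f := fun ρ => (meet ρ x).length)
    ((Set.finite_lt_nat n).subset ?_) (hw.mono fun ρ hρ => hρ.2)
  rintro _ ⟨ρ, hρ, rfl⟩
  by_contra hle
  exact hρ.1 (seg_prefix_of_le_length_meet (not_lt.1 hle))

/-! ### Local constancy -/

theorem isLocallyConstant_eval (ρ : List Bool) : IsLocallyConstant fun f : FStar => f ρ :=
  (IsLocallyConstant.iff_continuous _).2 (continuous_apply ρ)

theorem isLocallyConstant_F1 (ρ : List Bool) : IsLocallyConstant fun f : FStar => F1 f ρ := by
  rw [IsLocallyConstant.iff_eventually_eq]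
  intro f
  have : ∀ᶠ g in 𝓝 f, ∀ σ ∈ {σ : List Bool | σ.length < ρ.length}, g σ = f σ :=
    (Filter.eventually_all_finite (List.finite_length_lt Bool ρ.length)).2 fun σ _ =>
      (IsLocallyConstant.iff_eventually_eq _).1 (isLocallyConstant_eval σ) f
  filter_upwards [this] with g hg
  exact restr_eq_iff.2 hg

theorem isLocallyConstant_meet (ρ : List Bool) :
    IsLocallyConstant fun x : ℕ → Bool => meet ρ x := by
  induction ρ with
  | nil => exact .const []
  | cons a ρ ih =>
    have h0 : IsLocallyConstant fun x : ℕ → Bool => x 0 :=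
      (IsLocallyConstant.iff_continuous _).2 (continuous_apply 0)
    have h1 : IsLocallyConstant fun x : ℕ → Bool => meet ρ fun n => x (n + 1) :=
      ih.comp_continuous (f := fun (x : ℕ → Bool) n => x (n + 1)) (by fun_prop)
    exact h0.comp₂ h1 fun b ν => if a = b then a :: ν else []

theorem measurable_F1 : Measurable F1 :=
  (continuous_pi fun ρ => (isLocallyConstant_F1 ρ).continuous).measurable

/-! ### Compatibility of places and the description of `H₃` -/

/-- The values `f ρ` and `f ν` are functions on `2^{<lg ρ}` and `2^{<lg ν}`, and the second extends
the first. -/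
def Below (f : FStar) (ρ ν : List Bool) : Prop :=
  f ρ ∈ FStarN ρ.length ∧ f ν ∈ FStarN ν.length ∧ (f ρ).1 ⊆ (f ν).1

theorem Below.total_of_common_bound {f : FStar} {ρ ν σ : List Bool} (h : Below f ρ σ)
    (h' : Below f ν σ) : Below f ρ ν ∨ Below f ν ρ := by
  obtain ⟨⟨u, hu⟩, ⟨v, hv⟩, hs⟩ := h
  obtain ⟨⟨u', hu'⟩, -, hs'⟩ := h'
  rw [hu, hv, restr_subset_iff] at hs
  rw [hu', hv, restr_subset_iff] at hs'
  rcases le_total ρ.length ν.length with hle | hle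
  · refine .inl ⟨⟨u, hu⟩, ⟨u', hu'⟩, ?_⟩
    rw [hu, hu', restr_subset_iff]
    exact ⟨hle, fun τ hτ => (hs.2 τ hτ).trans (hs'.2 τ (hτ.trans_le hle)).symm⟩
  · refine .inr ⟨⟨u', hu'⟩, ⟨u, hu⟩, ?_⟩
    rw [hu, hu', restr_subset_iff]
    exact ⟨hle, fun τ hτ => (hs'.2 τ hτ).trans (hs.2 τ (hτ.trans_le hle)).symm⟩

/-- The places where `f` differs from `F₁(f)`; the value there is, for `b = true`, a function on
`2^{<lg ρ}` and, for `b = false`, not such a function. -/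
def Admissible (b : Bool) (f : FStar) (ρ : List Bool) : Prop :=
  f ρ ≠ F1 f ρ ∧ (f ρ ∈ FStarN ρ.length ↔ b = true)

/-- Two places may both belong to `w_g` for some `g ∈ G₂` with `f_g = f`, where `b` says which of
the two alternatives in the definition of `G₂` holds. -/
def Compatible (B : FStar → ℕ → Bool) (b : Bool) (f : FStar) : List Bool → List Bool → Prop :=
  RainbowAntichain (Admissible b f) (fun ρ => (meet ρ (B f)).length) (Below f)

theorem admissible_of_pairwise {B : FStar → ℕ → Bool} {b : Bool} {f : FStar} {w : Set (List Bool)}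
    (hw : w.Infinite) (hR : w.Pairwise (Compatible B b f)) {ρ : List Bool} (hρ : ρ ∈ w) :
    Admissible b f ρ := by
  obtain ⟨ν, hν, hne⟩ := hw.exists_notMem_finite (Set.finite_singleton ρ)
  exact (hR hν hρ hne).2.1

theorem injOn_length_meet_of_pairwise {B : FStar → ℕ → Bool} {b : Bool} {f : FStar}
    {w : Set (List Bool)} (hR : w.Pairwise (Compatible B b f)) :
    Set.InjOn (fun ρ => (meet ρ (B f)).length) w := by
  intro ρ hρ ν hν h
  by_contra hne
  exact (hR hρ hν hne).2.2.1 h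

theorem isIndex_of_mem_G2 {B : FStar → ℕ → Bool} {g : FStar} (hg : g ∈ G2 B) :
    IsIndex B g (idx B g) := by
  obtain ⟨f, hf⟩ := hg.1
  rwa [hf.idx_eq]

open Classical in
/-- The function that agrees with `f` on `w` and with `F₁(f)` elsewhere. -/
noncomputable def modify (f : FStar) (w : Set (List Bool)) : FStar :=
  fun ρ => if ρ ∈ w then f ρ else F1 f ρ

theorem difSet_modify {f : FStar} {w : Set (List Bool)} (hw : ∀ ρ ∈ w, f ρ ≠ F1 f ρ) :
    difSet (modify f w) (F1 f) = w := by
  ext ρ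
  simp only [difSet, eqSet, modify, Set.mem_compl_iff, Set.mem_ofPred_eq]
  split_ifs with h
  · simp [h, hw ρ h]
  · simp [h]

theorem isIndex_modify {B : FStar → ℕ → Bool} {f : FStar} {b : Bool} {w : Set (List Bool)}
    (hw : w.Infinite) (hR : w.Pairwise (Compatible B b f)) : IsIndex B (modify f w) f := by
  have hdif := difSet_modify fun ρ hρ => (admissible_of_pairwise hw hR hρ).1
  have hinj := injOn_length_meet_of_pairwise hR
  constructor
  · rwa [hdif]
  · rw [hdif]
    exact finite_not_seg_prefix hinj
  · rw [hdif]
    rintro ρ - ν hν μ hμ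
    exact hinj hν.2.1 hμ.2.1 (congrArg List.length (hν.2.2.trans hμ.2.2.symm))

theorem modify_mem_G2 {B : FStar → ℕ → Bool} {f : FStar} {b : Bool} {w : Set (List Bool)}
    (hw : w.Infinite) (hR : w.Pairwise (Compatible B b f)) : modify f w ∈ G2 B := by
  have hidx := isIndex_modify hw hR
  have hadm := fun ρ hρ => admissible_of_pairwise (ρ := ρ) hw hR hρ
  have hwSet : wSet B (modify f w) = w := by
    rw [wSet, hidx.idx_eq, difSet_modify fun ρ hρ => (hadm ρ hρ).1]
  have hval : ∀ ρ ∈ w, modify f w ρ = f ρ := fun ρ hρ => if_pos hρ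
  refine ⟨⟨f, hidx⟩, ?_, ?_⟩
  · rw [hwSet, hidx.idx_eq]
    exact hval
  · rw [hwSet]
    cases b with
    | false =>
      refine .inl fun ρ hρ => ?_
      rw [hval ρ hρ, (hadm ρ hρ).2]
      simp
    | true =>
      refine .inr fun ρ hρ ν hν hne => ?_
      have h1 := (hadm ρ hρ).2.2 rfl
      have h2 := (hadm ν hν).2.2 rfl
      rw [hval ρ hρ, hval ν hν]
      exact ⟨h1, fun hs => (hR hρ hν hne).2.2.2.1 ⟨h1, h2, hs⟩⟩

theorem extendable_of_mem_H3 {B : FStar → ℕ → Bool} {f : FStar} (hf : f ∈ H3 B) :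
    ∃ b, Extendable (Compatible B b f) ∅ := by
  obtain ⟨g, hg, rfl⟩ := hf
  have hidx := isIndex_of_mem_G2 hg
  obtain ⟨-, hval, halt⟩ := hg
  have hinf : (wSet B g).Infinite := hidx.infinite
  have hne : ∀ ρ ∈ wSet B g, idx B g ρ ≠ F1 (idx B g) ρ := by
    intro ρ hρ h
    exact hρ ((hval ρ hρ).trans h)
  have hcol : ∀ ρ ∈ wSet B g, ∀ ν ∈ wSet B g, ρ ≠ ν →
      (meet ρ (B (idx B g))).length ≠ (meet ν (B (idx B g))).length := by
    intro ρ hρ ν hν hρν h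
    have hm := meet_eq_of_length_eq h
    exact hρν (hidx.at_most_one _ (meet_eq_seg ρ _) ⟨meet_prefix _ _, hρ, rfl⟩
      ⟨hm ▸ meet_prefix _ _, hν, hm.symm⟩)
  rcases halt with h | h
  · refine ⟨false, extendable_empty_of_infinite hinf fun ρ hρ ν hν hρν => ?_⟩
    have hN : ∀ ρ ∈ wSet B g, idx B g ρ ∉ FStarN ρ.length := fun ρ hρ => hval ρ hρ ▸ h ρ hρ
    exact ⟨⟨hne ρ hρ, by simp [hN ρ hρ]⟩, ⟨hne ν hν, by simp [hN ν hν]⟩, hcol ρ hρ ν hν hρν,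
      fun hb => hN ρ hρ hb.1, fun hb => hN ρ hρ hb.2.1⟩
  · refine ⟨true, extendable_empty_of_infinite hinf fun ρ hρ ν hν hρν => ?_⟩
    obtain ⟨h1, h2⟩ := h ρ hρ ν hν hρν
    obtain ⟨h3, h4⟩ := h ν hν ρ hρ hρν.symm
    rw [hval ρ hρ] at h1 h2 h4
    rw [hval ν hν] at h2 h3 h4
    exact ⟨⟨hne ρ hρ, by simp [h1]⟩, ⟨hne ν hν, by simp [h3]⟩, hcol ρ hρ ν hν hρν,
      fun hb => h2 hb.2.2, fun hb => h4 hb.2.2⟩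

/-! ### A Borel selector -/

/-- An enumeration of the finite binary sequences. -/
noncomputable def enum : ℕ → List Bool := (exists_surjective_nat (List Bool)).choose

theorem enum_surjective : Function.Surjective enum := (exists_surjective_nat (List Bool)).choose_spec

open Classical in
/-- The alternative of `G₂` that is used for `f`; the second one has priority. -/
noncomputable def kind (B : FStar → ℕ → Bool) (f : FStar) : Bool :=
  decide (Extendable (Compatible B true f) ∅)

theorem extendable_kind {B : FStar → ℕ → Bool} {f : FStar}
    (h : ∃ b, Extendable (Compatible B b f) ∅) : Extendable (Compatible B (kind B f) f) ∅ := by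
  obtain ⟨b, hb⟩ := h
  by_cases ht : Extendable (Compatible B true f) ∅
  · simp [kind, ht]
  · cases b with
    | false => simpa [kind, ht] using hb
    | true => exact absurd hb ht

/-- The greedy infinite clique of compatible places. -/
def chosenSet (B : FStar → ℕ → Bool) (f : FStar) : Set (List Bool) :=
  greedySet (Compatible B (kind B f) f) enum

/-- Membership in `H₃` only depends on finite cliques of compatible places: the greedy procedure
turns arbitrarily large finite cliques into an infinite one. -/
theorem mem_H3_iff {B : FStar → ℕ → Bool} {f : FStar} :
    f ∈ H3 B ↔ Extendable (Compatible B (kind B f) f) ∅ := by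
  refine ⟨fun hf => extendable_kind (extendable_of_mem_H3 hf), fun h => ?_⟩
  have hinf := infinite_greedySet enum_surjective
    (fun _ _ _ h h' => h.total_of_common_bound h') h
  have hR := pairwise_greedySet enum h
  exact ⟨_, modify_mem_G2 hinf hR, (isIndex_modify hinf hR).idx_eq⟩

open Classical in
/-- The Borel selector. -/
noncomputable def select (B : FStar → ℕ → Bool) (f : FStar) : FStar :=
  if f ∈ H3 B then modify f (chosenSet B f) else F1 f

/-- Different functions `F₁(f)` differ at all places of almost all levels, which is too much for
membership in `G₁`. -/
theorem F1_notMem_G1 (B : FStar → ℕ → Bool) (f : FStar) : F1 f ∉ G1 B := by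
  rintro ⟨f', h⟩
  rcases eq_or_ne f f' with rfl | hne
  · exact h.infinite (by simp [difSet, eqSet])
  · obtain ⟨ρ, hρ⟩ := Function.ne_iff.1 hne
    classical
    set n := ρ.length + 2 with hn
    let s : Finset (List Bool) :=
      Finset.univ.map ⟨fun v : List.Vector Bool n => v.1, Subtype.val_injective⟩
    have hs : ∀ ν ∈ s, ν.length = n ∧ ν ∈ difSet (F1 f) (F1 f') := by
      intro ν hν
      obtain ⟨v, -, rfl⟩ := Finset.mem_map.1 hν
      have hv : v.1.length = n := v.2
      exact ⟨hv, fun he => hρ (restr_eq_iff.1 he ρ (show ρ.length < v.1.length by omega))⟩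
    have h1 := h.card_le n s hs
    have h2 : s.card = 2 ^ n := by simp [s]
    have h3 : ∀ m : ℕ, m + 2 + 1 < 2 ^ (m + 2) := by
      intro m
      induction m with
      | zero => norm_num
      | succ m ih => rw [show m + 1 + 2 = (m + 2) + 1 by ring, pow_succ]; omega
    have h4 := h3 ρ.length
    rw [← hn] at h4
    omega

section Measurability

variable {B : FStar → ℕ → Bool}

theorem measurableSet_compatible (hB : Continuous B) (b : Bool) (ρ ν : List Bool) :
    MeasurableSet {f | Compatible B b f ρ ν} := by
  have hm := fun σ => (isLocallyConstant_meet σ).comp_continuous hB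
  have hl := ((isLocallyConstant_eval ρ).prodMk (isLocallyConstant_F1 ρ)).prodMk <|
    ((isLocallyConstant_eval ν).prodMk (isLocallyConstant_F1 ν)).prodMk <| (hm ρ).prodMk (hm ν)
  exact (hl {p | (p.1.1 ≠ p.1.2 ∧ (p.1.1 ∈ FStarN ρ.length ↔ b = true)) ∧
    (p.2.1.1 ≠ p.2.1.2 ∧ (p.2.1.1 ∈ FStarN ν.length ↔ b = true)) ∧
    p.2.2.1.length ≠ p.2.2.2.length ∧
    ¬ (p.1.1 ∈ FStarN ρ.length ∧ p.2.1.1 ∈ FStarN ν.length ∧ p.1.1.1 ⊆ p.2.1.1.1) ∧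
    ¬ (p.2.1.1 ∈ FStarN ν.length ∧ p.1.1 ∈ FStarN ρ.length ∧ p.2.1.1.1 ⊆ p.1.1.1)}).measurableSet

theorem measurableSet_extendable_kind (hB : Continuous B) :
    MeasurableSet {f | Extendable (Compatible B (kind B f) f) ∅} := by
  have : {f | Extendable (Compatible B (kind B f) f) ∅} =
      {f | Extendable (Compatible B true f) ∅} ∪ {f | Extendable (Compatible B false f) ∅} := by
    ext f
    constructor
    · intro h
      rw [Set.mem_ofPred_eq] at h
      cases hk : kind B f <;> rw [hk] at h
      · exact .inr h
      · exact .inl h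
    · rintro (h | h) <;> exact extendable_kind ⟨_, h⟩
  rw [this]
  exact (measurableSet_extendable (measurableSet_compatible hB true) ∅).union
    (measurableSet_extendable (measurableSet_compatible hB false) ∅)

theorem measurableSet_H3 (hB : Continuous B) : MeasurableSet (H3 B) := by
  have : H3 B = {f | Extendable (Compatible B (kind B f) f) ∅} := Set.ext fun _ => mem_H3_iff
  rw [this]
  exact measurableSet_extendable_kind hB

theorem measurableSet_mem_chosenSet (hB : Continuous B) (ρ : List Bool) :
    MeasurableSet {f | ρ ∈ chosenSet B f} := by
  have : {f | ρ ∈ chosenSet B f} =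
      {f | Extendable (Compatible B true f) ∅} ∩ {f | ρ ∈ greedySet (Compatible B true f) enum} ∪
      {f | Extendable (Compatible B true f) ∅}ᶜ ∩
        {f | ρ ∈ greedySet (Compatible B false f) enum} := by
    ext f
    by_cases h : Extendable (Compatible B true f) ∅ <;> simp [chosenSet, kind, h]
  rw [this]
  have hm := measurableSet_extendable (measurableSet_compatible hB true) ∅
  exact (hm.inter (measurableSet_mem_greedySet enum (measurableSet_compatible hB true) ρ)).union
    (hm.compl.inter (measurableSet_mem_greedySet enum (measurableSet_compatible hB false) ρ))

theorem measurable_select (hB : Continuous B) : Measurable (select B) := by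
  classical
  refine Measurable.ite (measurableSet_H3 hB) (measurable_pi_iff.2 fun ρ => ?_) measurable_F1
  exact Measurable.ite (measurableSet_mem_chosenSet hB ρ) (measurable_pi_apply ρ)
    ((measurable_pi_apply ρ).comp measurable_F1)

theorem isSelector_select (hB : Continuous B) : IsSelector B (select B) := by
  have key : ∀ f ∈ H3 B, select B f ∈ G2 B ∧ idx B (select B f) = f := by
    intro f hf
    rw [select, if_pos hf]
    have h := mem_H3_iff.1 hf
    have hinf := infinite_greedySet enum_surjective
      (fun _ _ _ h h' => h.total_of_common_bound h') h
    have hR := pairwise_greedySet enum h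
    exact ⟨modify_mem_G2 hinf hR, (isIndex_modify hinf hR).idx_eq⟩
  refine ⟨?_, fun f => ⟨fun hf => (key f hf).1, fun hg => ?_⟩, fun f hf => (key f hf).2⟩
  · rw [borel_FStar_eq]
    exact measurable_select hB
  · by_contra hf
    rw [select, if_neg hf] at hg
    exact F1_notMem_G1 B f hg.1

theorem IsSelector.measurableSet_G4 {F3 : FStar → FStar} (hF : IsSelector B F3)
    (hB : Continuous B) : MeasurableSet (G4 B F3) := by
  have hm : Measurable F3 := by
    have := hF.borel
    rwa [borel_FStar_eq] at this
  have hinj : Set.InjOn F3 (H3 B) := by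
    intro f hf f' hf' h
    rw [← hF.idx_eq f hf, ← hF.idx_eq f' hf', h]
  exact ((measurableSet_H3 hB).image_of_measurable_injOn hm hinj).union
    ((measurableSet_H3 hB).compl.image_of_measurable_injOn measurable_F1 F1_injective.injOn)

end Measurability

/-! ### The family `G₄` is eventually different -/

theorem finite_eqSet_F1_of_mem_G2 {B : FStar → ℕ → Bool} {g f' : FStar} (hg : g ∈ G2 B)
    (hne : idx B g ≠ f') : (eqSet g (F1 f')).Finite := by
  obtain ⟨-, hval, halt⟩ := hg
  have hw : {ρ | ρ ∈ wSet B g ∧ g ρ = F1 f' ρ}.Finite := by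
    rcases halt with h | h
    · refine Set.Finite.subset Set.finite_empty ?_
      rintro ρ ⟨hρ, he⟩
      exact h ρ hρ (he ▸ F1_mem_FStarN f' ρ)
    · refine Set.Subsingleton.finite ?_
      rintro ρ ⟨hρ, he⟩ ν ⟨hν, he'⟩
      by_contra hρν
      rcases le_total ρ.length ν.length with hle | hle
      · refine (h ρ hρ ν hν hρν).2 ?_
        rw [he, he']
        exact restr_subset_iff.2 ⟨hle, fun _ _ => rfl⟩
      · refine (h ν hν ρ hρ (Ne.symm hρν)).2 ?_
        rw [he, he']
        exact restr_subset_iff.2 ⟨hle, fun _ _ => rfl⟩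
  refine (hw.union (finite_eqSet_F1 hne)).subset fun ρ hρ => ?_
  by_cases h : ρ ∈ wSet B g
  · exact .inl ⟨h, hρ⟩
  · exact .inr ((not_not.1 h : g ρ = F1 (idx B g) ρ).symm.trans hρ)

theorem finite_eqSet_of_mem_G2 {B : FStar → ℕ → Bool} (hB : Function.Injective B) {g g' : FStar}
    (hg : g ∈ G2 B) (hg' : g' ∈ G2 B) (hne : idx B g ≠ idx B g') : (eqSet g g').Finite := by
  have hww : (wSet B g ∩ wSet B g').Finite := finite_inter_of_ne (hB.ne hne)
    (isIndex_of_mem_G2 hg).finite_off (isIndex_of_mem_G2 hg').finite_off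
  refine (hww.union ((finite_eqSet_F1_of_mem_G2 hg hne).union
    (finite_eqSet_F1_of_mem_G2 hg' hne.symm))).subset fun ρ hρ => ?_
  have hρ' : g ρ = g' ρ := hρ
  by_cases h : ρ ∈ wSet B g
  · by_cases h' : ρ ∈ wSet B g'
    · exact .inl ⟨h, h'⟩
    · exact .inr (.inl (hρ'.trans (not_not.1 h' : g' ρ = F1 (idx B g') ρ)))
  · exact .inr (.inr (hρ'.symm.trans (not_not.1 h : g ρ = F1 (idx B g) ρ)))

theorem eqSet_comm (f g : FStar) : eqSet f g = eqSet g f := Set.ext fun _ => eq_comm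

theorem IsSelector.G4_mem_EDF {B : FStar → ℕ → Bool} {F3 : FStar → FStar} (hF : IsSelector B F3)
    (hB : Function.Injective B) : G4 B F3 ∈ EDF := by
  rintro _ (⟨f, hf, rfl⟩ | ⟨f, hf, rfl⟩) _ (⟨f', hf', rfl⟩ | ⟨f', hf', rfl⟩) hne
  · refine finite_eqSet_of_mem_G2 hB ((hF.mem_iff f).1 hf) ((hF.mem_iff f').1 hf') fun h => hne ?_
    rw [hF.idx_eq f hf, hF.idx_eq f' hf'] at h
    rw [h]
  · refine finite_eqSet_F1_of_mem_G2 ((hF.mem_iff f).1 hf) ?_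
    rw [hF.idx_eq f hf]
    rintro rfl
    exact hf' hf
  · rw [eqSet_comm]
    refine finite_eqSet_F1_of_mem_G2 ((hF.mem_iff f').1 hf') ?_
    rw [hF.idx_eq f' hf']
    rintro rfl
    exact hf hf'
  · exact finite_eqSet_F1 fun h => hne (h ▸ rfl)

/-! ### Every function meets `G₄` infinitely often -/

theorem pairwise_length_meet_offBranch_ne (x : ℕ → Bool) {n m : ℕ} (h : n ≠ m) :
    (meet (offBranch x n) x).length ≠ (meet (offBranch x m) x).length := by
  rwa [length_meet_offBranch, length_meet_offBranch]

/-- If `f ∉ H₃` and `f` differs from `F₁(f)` along the sequences leaving `B f`, then the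
Erdős–Szekeres dichotomy applied to the values of `f` there yields a chain; its union is a function
`f'` such that `F₁(f')` agrees with `f` at infinitely many of these places. -/
theorem exists_F1_eq_of_notMem_H3 {B : FStar → ℕ → Bool} {f : FStar} (hf : f ∉ H3 B)
    (hdif : {n | f (offBranch (B f) n) = F1 f (offBranch (B f) n)}.Finite) :
    ∃ f' : FStar, {n | f (offBranch (B f) n) = F1 f' (offBranch (B f) n)}.Infinite := by
  classical
  set p := offBranch (B f) with hp
  have hpinj : Function.Injective p := offBranch_injective _
  have hnext : ∀ b, ¬ Extendable (Compatible B b f) ∅ := fun b hb =>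
    hf (mem_H3_iff.2 (extendable_kind ⟨b, hb⟩))
  have hout : {n | f (p n) ≠ F1 f (p n) ∧ f (p n) ∉ FStarN (p n).length}.Finite := by
    by_contra hinf
    refine hnext false (extendable_empty_of_infinite
      (Set.Infinite.image hpinj.injOn hinf) ?_)
    rintro _ ⟨n, hn, rfl⟩ _ ⟨m, hm, rfl⟩ hnm
    exact ⟨⟨hn.1, by simp [hn.2]⟩, ⟨hm.1, by simp [hm.2]⟩,
      pairwise_length_meet_offBranch_ne _ (fun h => hnm (h ▸ rfl)),
      fun h => hn.2 h.1, fun h => hm.2 h.1⟩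
  have hA : {n | f (p n) ≠ F1 f (p n) ∧ f (p n) ∈ FStarN (p n).length}.Infinite := by
    intro hfin
    refine Set.infinite_univ ((hfin.union (hout.union hdif)).subset fun n _ => ?_)
    by_cases h1 : f (p n) = F1 f (p n)
    · exact .inr (.inr h1)
    · by_cases h2 : f (p n) ∈ FStarN (p n).length
      · exact .inl ⟨h1, h2⟩
      · exact .inr (.inl ⟨h1, h2⟩)
  set A := {n | f (p n) ≠ F1 f (p n) ∧ f (p n) ∈ FStarN (p n).length}
  have : Infinite A := hA.to_subtype
  set a : ℕ ↪o ℕ := Nat.orderEmbeddingOfSet A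
  have haA : ∀ k, a k ∈ A := fun k => Nat.orderEmbeddingOfSet_range A ▸ Set.mem_range_self k
  have : IsTrans HF fun x y => x.1 ⊆ y.1 := ⟨fun _ _ _ h h' _ hz => h' (h hz)⟩
  obtain ⟨j, hchain | hanti⟩ := exists_increasing_or_nonincreasing_subseq
    (fun x y : HF => x.1 ⊆ y.1) fun k => f (p (a k))
  · set i : ℕ → ℕ := fun k => a (j k)
    have hmono : StrictMono i := a.strictMono.comp j.strictMono
    have hlen : ∀ k, (p (i k)).length = i k + 1 := fun k => length_offBranch _ _
    choose u hu using fun k => (haA (j k)).2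
    have hagree : ∀ k l, k ≤ l → ∀ σ : List Bool, σ.length < i k + 1 → u k σ = u l σ := by
      intro k l hkl σ hσ
      rcases hkl.eq_or_lt with rfl | hlt
      · rfl
      · have h := hchain k l hlt
        rw [hu k, hu l, restr_subset_iff] at h
        exact h.2 σ (hσ.trans_eq (hlen k).symm)
    refine ⟨fun σ => u σ.length σ, (Set.infinite_range_of_injective hmono.injective).mono ?_⟩
    rintro _ ⟨k, rfl⟩
    change f (p (i k)) = restr _ (p (i k)).length
    rw [hu k]
    refine restr_eq_iff.2 fun σ hσ => ?_
    have hσ' : σ.length < i k + 1 := hσ.trans_eq (hlen k)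
    rcases le_total k σ.length with hle | hle
    · exact hagree k _ hle σ hσ'
    · exact (hagree _ k hle σ (Nat.lt_succ_of_le hmono.le_apply)).symm
  · refine absurd (extendable_empty_of_infinite (w := Set.range fun k => p (a (j k)))
      (Set.infinite_range_of_injective (hpinj.comp (a.injective.comp j.injective))) ?_) (hnext true)
    -- longer domains cannot be included in shorter ones, so one direction suffices
    have hkey : ∀ k l, k < l → Compatible B true f (p (a (j k))) (p (a (j l))) := by
      intro k l hkl
      have hlt : a (j k) < a (j l) := a.strictMono (j.strictMono hkl)
      have hk := haA (j k)
      have hl := haA (j l)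
      refine ⟨⟨hk.1, by simp [hk.2]⟩, ⟨hl.1, by simp [hl.2]⟩,
        pairwise_length_meet_offBranch_ne _ hlt.ne, fun h => hanti k l hkl h.2.2, ?_⟩
      rintro ⟨⟨u, hu⟩, ⟨v, hv⟩, hs⟩
      rw [hu, hv, restr_subset_iff] at hs
      have h1 := hs.1
      simp only [hp, length_offBranch] at h1
      omega
    rintro _ ⟨k, rfl⟩ _ ⟨l, rfl⟩ hkl
    rcases lt_trichotomy k l with h | rfl | h
    · exact hkey k l h
    · exact absurd rfl hkl
    · exact (hkey l k h).symm

theorem IsSelector.exists_infinite_eqSet {B : FStar → ℕ → Bool} {F3 : FStar → FStar}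
    (hF : IsSelector B F3) (hB : Function.Injective B) (f : FStar) :
    ∃ g ∈ G4 B F3, (eqSet f g).Infinite := by
  by_cases hf : f ∈ H3 B
  · refine ⟨F3 f, .inl ⟨f, hf, rfl⟩, ?_⟩
    have hg := (hF.mem_iff f).1 hf
    have hidx := hF.idx_eq f hf
    refine (isIndex_of_mem_G2 hg).infinite.mono fun ρ hρ => ?_
    have := hg.2.1 ρ hρ
    rw [hidx] at this
    exact this.symm
  have hinj := offBranch_injective (B f)
  by_cases hdif : {n | f (offBranch (B f) n) = F1 f (offBranch (B f) n)}.Finite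
  swap
  · refine ⟨F1 f, .inr ⟨f, hf, rfl⟩, (Set.Infinite.image hinj.injOn hdif).mono ?_⟩
    rintro _ ⟨n, hn, rfl⟩
    exact hn
  obtain ⟨f', hf'⟩ := exists_F1_eq_of_notMem_H3 hf hdif
  have hne : f ≠ f' := by
    rintro rfl
    exact hf' hdif
  have hinf := Set.Infinite.image hinj.injOn hf'
  by_cases hf'3 : f' ∈ H3 B
  swap
  · refine ⟨F1 f', .inr ⟨f', hf'3, rfl⟩, hinf.mono ?_⟩
    rintro _ ⟨n, hn, rfl⟩
    exact hn
  · refine ⟨F3 f', .inl ⟨f', hf'3, rfl⟩, ?_⟩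
    have hidx := isIndex_of_mem_G2 ((hF.mem_iff f').1 hf'3)
    rw [hF.idx_eq f' hf'3] at hidx
    -- the places leaving `B f` and the exceptional places of `F3 f'` converge to different points
    have hfin : (Set.range (offBranch (B f)) ∩ difSet (F3 f') (F1 f')).Finite := by
      refine finite_inter_of_ne (hB.ne hne) (finite_not_seg_prefix ?_) hidx.finite_off
      rintro _ ⟨n, rfl⟩ _ ⟨m, rfl⟩ h
      by_contra hnm
      exact pairwise_length_meet_offBranch_ne _ (fun h' => hnm (congrArg _ h')) h
    refine (hinf.sdiff hfin).mono ?_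
    rintro _ ⟨⟨n, hn, rfl⟩, hnot⟩
    by_contra hcon
    exact hnot ⟨⟨n, rfl⟩, fun he => hcon (hn.trans he.symm)⟩

/-- A family in `EDF` that meets every function infinitely often cannot be enlarged. -/
theorem mem_MEDF_of_forall_exists_infinite {F : Set FStar} (hF : F ∈ EDF)
    (h : ∀ f : FStar, ∃ g ∈ F, (eqSet f g).Infinite) : F ∈ MEDF := by
  refine ⟨hF, fun F' hF' hsub f hf => ?_⟩
  obtain ⟨g, hg, hinf⟩ := h f
  by_contra hfF
  exact hinf (hF' f hf g (hsub hg) fun he => hfF (he ▸ hg))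

end EvDiff

theorem claim8 (B : EvDiff.FStar → ℕ → Bool) (hBcont : Continuous B)
    (hBinj : Function.Injective B) :
    (∃ F3 : EvDiff.FStar → EvDiff.FStar, EvDiff.IsSelector B F3) ∧
    ∀ F3 : EvDiff.FStar → EvDiff.FStar, EvDiff.IsSelector B F3 →
      (@MeasurableSet EvDiff.FStar (borel EvDiff.FStar) (EvDiff.G4 B F3) ∧
        EvDiff.G4 B F3 ⊆ EvDiff.G0 ∪ EvDiff.G2 B ∧ EvDiff.G2 B ⊆ EvDiff.G1 B) ∧
      EvDiff.G4 B F3 ∈ EvDiff.EDF ∧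
      EvDiff.G4 B F3 ∈ EvDiff.MEDF ∧
      ∀ f : EvDiff.FStar, ∃ g ∈ EvDiff.G4 B F3, (EvDiff.eqSet f g).Infinite := by
  refine ⟨⟨_, EvDiff.isSelector_select hBcont⟩, fun F3 hF => ?_⟩
  have hEDF := hF.G4_mem_EDF hBinj
  have hinf := hF.exists_infinite_eqSet hBinj
  refine ⟨⟨?_, ?_, fun g hg => hg.1⟩, hEDF, EvDiff.mem_MEDF_of_forall_exists_infinite hEDF hinf,
    hinf⟩
  · rw [EvDiff.borel_FStar_eq]
    exact hF.measurableSet_G4 hBcont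
  · rintro _ (⟨f, hf, rfl⟩ | ⟨f, -, rfl⟩)
    · exact .inr ((hF.mem_iff f).1 hf)
    · exact .inl ⟨f, rfl⟩
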